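/- All Hilbert spaces are complex. A linear relation in a Hilbert space $\mathcal H$ is a linear subspace $S\subset\mathcal H\times\mathcal H$; operators are identified with their graphs. Its adjoint is $S^*=\{(g,g') : (f',g)=(f,g')\ \text{for all } (f,f')\in S\}$, and $S$ is symmetric (self-adjoint) if $S\subset S^*$ ($S=S^*$). The resolvent set $\rho(S)$ is the set of $\lambda\in\mathbb C$ for which $(S-\lambda)^{-1}=\{(f'-\lambda f,f):(f,f')\in S\}$ is a bounded, everywhere defined operator. The essential spectrum $\sigma_{\rm ess}(\Theta)$ of a self-adjoint relation $\Theta$ in a Hilbert space $\mathcal G$ is the set of $\lambda\in\mathbb R$ for which $\Theta_{\rm op}-\lambda$ is not Fredholm, where $\Theta_{\rm op}$ is the self-adjoint operator part of $\Theta$, that is, the restriction of $\Theta$ to $\overline{\operatorname{dom}\Theta}$. A class of operator ideals $\mathfrak A$ assigns to every pair of separable Hilbert spaces $\mathcal H,\mathcal K$ a set $\mathfrak A(\mathcal H,\mathcal K)$ of compact operators from $\mathcal H$ to $\mathcal K$ that contains all rank-one operators $x\mapsto(x,u)v$, is closed under addition, and satisfies $CAB\in\mathfrak A(\mathcal H_1,\mathcal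 K_1)$ for all $A\in\mathfrak A(\mathcal H,\mathcal K)$ and all bounded operators $B:\mathcal H_1\to\mathcal H$, $C:\mathcal K\to\mathcal K_1$. Put $\mathfrak A^*(\mathcal H,\mathcal K)=\{A^*:A\in\mathfrak A(\mathcal K,\mathcal H)\}$, and let $(\mathfrak A\cdot\mathfrak A^*)(\mathcal H)$ be the set of all products $AB$ with $B\in\mathfrak A^*(\mathcal H,\mathcal L)$ and $A\in\mathfrak A(\mathcal L,\mathcal H)$ for some separable Hilbert space $\mathcal L$. Let $A$ be a closed symmetric relation in a Hilbert space $\mathcal H$. A quasi boundary triple $\{\mathcal G,\Gamma_0,\Gamma_1\}$ for $A^*$ consists of a Hilbert space $\mathcal G$ and linear maps $\Gamma_0,\Gamma_1:T\to\mathcal G$ on a dense subspace $T$ of $A^*$ such that $\{(\Gamma_0\hat f,\Gamma_1\hat f):\hat f\in T\}$ is dense in $\mathcal G\times\mathcal G$, the relation $A_0:=\ker\Gamma_0$ is self-adjoint, and $$(f',g)-(f,g')=(\Gamma_1\hat f,\Gamma_0\hat g)-(\Gamma_0\hat f,\Gamma_1\hat g)\qquad\text{for all }\hat f=(f,f'),\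 \hat g=(g,g')\in T.$$ For $\lambda\in\rho(A_0)$ its $\gamma$-field and Weyl function are the operators, defined on $\operatorname{ran}\Gamma_0\subset\mathcal G$, with $\gamma(\lambda)\Gamma_0\hat f=f$ and $M(\lambda)\Gamma_0\hat f=\Gamma_1\hat f$ for all $\hat f=(f,\lambda f)\in T$. For a linear relation $\Theta$ in $\mathcal G$ put $A_\Theta:=\{\hat f\in T:(\Gamma_0\hat f,\Gamma_1\hat f)\in\Theta\}$. **Theorem.** Let $A$ be a closed symmetric relation in a separable Hilbert space $\mathcal H$, let $\{\mathcal G,\Gamma_0,\Gamma_1\}$ be a quasi boundary triple for $A^*$ with $A_0=\ker\Gamma_0$, $\gamma$-field $\gamma$ and Weyl function $M$, let $\mathfrak A$ be a class of operator ideals, and let $\Theta$ be a self-adjoint relation in $\mathcal G$. Assume that 1. the closure $\overline{M(\lambda_0)}$ is a compact, everywhere defined operator in $\mathcal G$ for some $\lambda_0\in\mathbb C\setminus\mathbb R$; 2. $\gamma(\lambda_1)^*\in\mathfrak A^*(\mathcal H,\mathcal G)$ for some $\lambda_1\in\rho(A_0)$; 3. $0\notin\sigma_{\rm ess}(\Theta)$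 and $A_\Theta=A_\Theta^*$. Then $$(A_\Theta-\lambda)^{-1}-(A_0-\lambda)^{-1}\in(\mathfrak A\cdot\mathfrak A^*)(\mathcal H)\qquad\text{for all }\lambda\in\rho(A_\Theta)\cap\rho(A_0).$$ -/

import Mathlib

universe u

namespace LinRel

variable {E F : Type u} [NormedAddCommGroup E] [InnerProductSpace ℂ E]
  [NormedAddCommGroup F] [InnerProductSpace ℂ F]

/-! A linear relation from `E` to `F` is a linear subspace of `E × F`, that is, a term of
`Submodule ℂ (E × F)`; operators are viewed as relations via their graphs. The adjoint relation
is Mathlib's `Submodule.adjoint`, the closure is `Submodule.topologicalClosure`. -/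

/-- The domain of a linear relation. -/
def dom (S : Submodule ℂ (E × F)) : Submodule ℂ E := S.map (LinearMap.fst ℂ E F)

/-- The range of a linear relation. -/
def ran (S : Submodule ℂ (E × F)) : Submodule ℂ F := S.map (LinearMap.snd ℂ E F)

/-- The kernel `{f | (f, 0) ∈ S}` of a linear relation. -/
def ker (S : Submodule ℂ (E × F)) : Submodule ℂ E := S.comap (LinearMap.inl ℂ E F)

/-- The inverse relation. -/
def inv (S : Submodule ℂ (E × F)) : Submodule ℂ (F × E) :=
  S.map ((LinearMap.snd ℂ E F).prod (LinearMap.fst ℂ E F))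

/-- The relation `S - z`, consisting of all `(f, f' - z f)` with `(f, f') ∈ S`. -/
def shift (S : Submodule ℂ (E × E)) (z : ℂ) : Submodule ℂ (E × E) :=
  S.map ((LinearMap.fst ℂ E E).prod (LinearMap.snd ℂ E E - z • LinearMap.fst ℂ E E))

/-- A relation is symmetric if it is contained in its adjoint. -/
def IsSymm (S : Submodule ℂ (E × E)) : Prop := S ≤ S.adjoint

/-- A relation is self-adjoint if it equals its adjoint. -/
def IsSelfAdj (S : Submodule ℂ (E × E)) : Prop := S = S.adjoint

/-- The relation `S` is (the graph of) a bounded, everywhere defined operator, and this operator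
belongs to the set `𝒮` of bounded operators. -/
def IsOpIn (S : Submodule ℂ (E × F)) (𝒮 : Set (E →L[ℂ] F)) : Prop :=
  ∃ B ∈ 𝒮, LinearMap.graph (B : E →ₗ[ℂ] F) = S

/-- The resolvent set: all `z` such that `(S - z)⁻¹` is a bounded, everywhere defined operator. -/
def resolventSet (S : Submodule ℂ (E × E)) : Set ℂ :=
  {z | IsOpIn (inv (shift S z)) Set.univ}

open Classical in
/-- The resolvent `(S - z)⁻¹` as a bounded operator, for `z` in the resolvent set of `S`
(and `0` for other `z`). -/
noncomputable def resolvent (S : Submodule ℂ (E × E)) (z : ℂ) : E →L[ℂ] E :=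
  if h : z ∈ resolventSet S then Classical.choose h else 0

theorem graph_resolvent (S : Submodule ℂ (E × E)) {z : ℂ} (h : z ∈ resolventSet S) :
    LinearMap.graph (resolvent S z : E →ₗ[ℂ] E) = inv (shift S z) := by
  rw [resolvent, dif_pos h]
  exact (Classical.choose_spec h).2

/-- Fredholm property of a (closed, possibly unbounded) operator given by its graph: closed,
finite-dimensional kernel, closed range of finite codimension. -/
def IsFredholm (T : Submodule ℂ (E × F)) : Prop :=
  IsClosed (T : Set (E × F)) ∧ FiniteDimensional ℂ (ker T) ∧
    IsClosed (ran T : Set F) ∧ FiniteDimensional ℂ (F ⧸ ran T)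

/-- The essential spectrum of a closed operator `T`: all `z` such that `T - z` is not Fredholm. -/
def essSpectrumOp (T : Submodule ℂ (E × E)) : Set ℂ := {z | ¬ IsFredholm (shift T z)}

/-- The operator part of a self-adjoint relation `S`: the restriction `S ∩ (K × K)` of `S` to the
Hilbert space `K`, the closure of `dom S`. -/
def opPart (S : Submodule ℂ (E × E)) :
    Submodule ℂ ((dom S).topologicalClosure × (dom S).topologicalClosure) :=
  S.comap ((dom S).topologicalClosure.subtype.prodMap (dom S).topologicalClosure.subtype)

/-- The essential spectrum of a self-adjoint relation is that of its operator part. -/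
def essSpectrum (S : Submodule ℂ (E × E)) : Set ℝ := {x | (x : ℂ) ∈ essSpectrumOp (opPart S)}

end LinRel

/-- A family of sets `𝔄(H, K)` of bounded operators, indexed by pairs of complex Hilbert
spaces. -/
def OpFamily : Type (u + 1) :=
  ∀ (H K : Type u) [NormedAddCommGroup H] [InnerProductSpace ℂ H] [CompleteSpace H]
    [NormedAddCommGroup K] [InnerProductSpace ℂ K] [CompleteSpace K], Set (H →L[ℂ] K)

/-- The compact operators from `H` to `K`. -/
def compactOps : OpFamily.{u} := fun _ _ => {A | IsCompactOperator A}

namespace OpFamily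

open TopologicalSpace

/-- `𝔄` is a class of operator ideals. The index set of the notion consists of the pairs of
separable Hilbert spaces: nothing is required of `𝔄(H, K)` if `H` or `K` is not separable. -/
structure IsClassOfIdeals (𝔄 : OpFamily.{u}) : Prop where
  compact : ∀ (H K : Type u) [NormedAddCommGroup H] [InnerProductSpace ℂ H] [CompleteSpace H]
    [SeparableSpace H] [NormedAddCommGroup K] [InnerProductSpace ℂ K] [CompleteSpace K]
    [SeparableSpace K], 𝔄 H K ⊆ compactOps H K
  rankOne : ∀ (H K : Type u) [NormedAddCommGroup H] [InnerProductSpace ℂ H] [CompleteSpace H]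
    [SeparableSpace H] [NormedAddCommGroup K] [InnerProductSpace ℂ K] [CompleteSpace K]
    [SeparableSpace K] (x : H) (y : K), (innerSL ℂ x).smulRight y ∈ 𝔄 H K
  add : ∀ (H K : Type u) [NormedAddCommGroup H] [InnerProductSpace ℂ H] [CompleteSpace H]
    [SeparableSpace H] [NormedAddCommGroup K] [InnerProductSpace ℂ K] [CompleteSpace K]
    [SeparableSpace K] (A B : H →L[ℂ] K), A ∈ 𝔄 H K → B ∈ 𝔄 H K → A + B ∈ 𝔄 H K
  comp : ∀ (H K H₁ K₁ : Type u)
    [NormedAddCommGroup H] [InnerProductSpace ℂ H] [CompleteSpace H] [SeparableSpace H]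
    [NormedAddCommGroup K] [InnerProductSpace ℂ K] [CompleteSpace K] [SeparableSpace K]
    [NormedAddCommGroup H₁] [InnerProductSpace ℂ H₁] [CompleteSpace H₁] [SeparableSpace H₁]
    [NormedAddCommGroup K₁] [InnerProductSpace ℂ K₁] [CompleteSpace K₁] [SeparableSpace K₁]
    (A : H →L[ℂ] K) (B : H₁ →L[ℂ] H) (C : K →L[ℂ] K₁),
    A ∈ 𝔄 H K → C ∘L A ∘L B ∈ 𝔄 H₁ K₁

/-- The adjoint family `𝔄*(H, K) = {A* | A ∈ 𝔄(K, H)}`. -/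
noncomputable def star (𝔄 : OpFamily.{u}) : OpFamily.{u} := fun H K =>
  {T | ∃ A ∈ 𝔄 K H, T = ContinuousLinearMap.adjoint A}

/-- The product family: `(𝔄 · 𝔅)(H, K)` is the set of all products `A B` with `B ∈ 𝔅(H, L)` and
`A ∈ 𝔄(L, K)` for some separable Hilbert space `L`. -/
def mul (𝔄 𝔅 : OpFamily.{u}) : OpFamily.{u} := fun H K =>
  {T | ∃ (L : Type u) (_ : NormedAddCommGroup L) (_ : InnerProductSpace ℂ L)
    (_ : CompleteSpace L) (_ : SeparableSpace L), ∃ A ∈ 𝔄 L K, ∃ B ∈ 𝔅 H L, T = A ∘L B}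

end OpFamily

/-- A quasi boundary triple `{G, Γ₀, Γ₁}` for `A*`, where `A` is a (closed symmetric) relation in
`H`. Mathlib's inner product is conjugate-linear in its first argument, so `(x, y)` in the usual
form of Green's identity is `inner ℂ y x`. -/
structure QuasiBoundaryTriple {H : Type u} [NormedAddCommGroup H] [InnerProductSpace ℂ H]
    (A : Submodule ℂ (H × H)) (G : Type u) [NormedAddCommGroup G] [InnerProductSpace ℂ G] where
  /-- the common domain of the boundary maps -/
  T : Submodule ℂ (H × H)
  /-- first boundary map -/
  Γ₀ : T →ₗ[ℂ] G
  /-- second boundary map -/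
  Γ₁ : T →ₗ[ℂ] G
  T_le : T ≤ A.adjoint
  dense_T : A.adjoint ≤ T.topologicalClosure
  dense_ran : DenseRange (Γ₀.prod Γ₁)
  selfAdj_ker : LinRel.IsSelfAdj ((LinearMap.ker Γ₀).map T.subtype)
  green : ∀ f g : T,
    inner ℂ (g : H × H).1 (f : H × H).2 - inner ℂ (g : H × H).2 (f : H × H).1 =
      inner ℂ (Γ₀ g) (Γ₁ f) - inner ℂ (Γ₁ g) (Γ₀ f)

namespace QuasiBoundaryTriple

variable {H G : Type u} [NormedAddCommGroup H] [InnerProductSpace ℂ H]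
  [NormedAddCommGroup G] [InnerProductSpace ℂ G] {A : Submodule ℂ (H × H)}

/-- `A₀ = ker Γ₀`, as a relation in `H`. -/
def A₀ (Γ : QuasiBoundaryTriple A G) : Submodule ℂ (H × H) :=
  (LinearMap.ker Γ.Γ₀).map Γ.T.subtype

/-- `A_Θ`, consisting of all `f ∈ T` with `(Γ₀ f, Γ₁ f) ∈ Θ`. -/
def ext (Γ : QuasiBoundaryTriple A G) (Θ : Submodule ℂ (G × G)) : Submodule ℂ (H × H) :=
  (Θ.comap (Γ.Γ₀.prod Γ.Γ₁)).map Γ.T.subtype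

/-- The subspace of all elements of `T` of the form `(f, z f)`. -/
def defect (Γ : QuasiBoundaryTriple A G) (z : ℂ) : Submodule ℂ Γ.T :=
  LinearMap.ker ((LinearMap.snd ℂ H H - z • LinearMap.fst ℂ H H) ∘ₗ Γ.T.subtype)

/-- The graph of the operator `γ(z)` from `G` to `H`: all `(Γ₀ f, π₁ f)` with `f` in the defect
subspace at `z`; here `z` is taken in the resolvent set of `A₀`. -/
def gammaField (Γ : QuasiBoundaryTriple A G) (z : ℂ) : Submodule ℂ (G × H) :=
  (Γ.defect z).map (Γ.Γ₀.prod (LinearMap.fst ℂ H H ∘ₗ Γ.T.subtype))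

/-- The graph of the operator `M(z)` in `G`: all `(Γ₀ f, Γ₁ f)` with `f` in the defect subspace
at `z`; here `z` is taken in the resolvent set of `A₀`. -/
def weyl (Γ : QuasiBoundaryTriple A G) (z : ℂ) : Submodule ℂ (G × G) :=
  (Γ.defect z).map (Γ.Γ₀.prod Γ.Γ₁)

end QuasiBoundaryTriple

/-!
The resolvent difference is factored through the space of boundary values. Throughout, `z` is in
the resolvent set of `A₀ = ker Γ₀`.

Green's identity shows that `B z : h ↦ Γ₁ ((A₀ - z)⁻¹ h, h + z (A₀ - z)⁻¹ h)` is the adjoint of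
`γ(z̄)`; the maps `B z` and `B w` differ by a bounded factor `1 + (z - w) (A₀ - z)⁻¹` on the right.
So the hypothesis at one point `z₁` makes every `B z` a bounded operator in `𝔄*`, and `(B z̄)*` is
an operator in `𝔄` that extends `γ(z)`. If the closure `M` of the Weyl function at one non-real
point `z₀` is bounded and everywhere defined, then `(B z̄)*` is injective
(`QuasiBoundaryTriple.eq_zero_of_inner_Γ₁_eq_zero`): a vector `φ` in its kernel yields a vector
`(M φ, φ)` annihilating the dense set of boundary values. In particular `G` is separable.

Let now `z` also be in the resolvent set of `A_Θ`, and for `h` in `H` let `Φ h` be the value of `Γ₀`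
at `((A_Θ - z)⁻¹ h, h + z (A_Θ - z)⁻¹ h)`. The two elements of `T` with first components
`(A_Θ - z)⁻¹ h` and `(A₀ - z)⁻¹ h` differ by an element of the defect subspace at `z`, so that the
resolvent difference equals `(B z̄)* Φ`. As `(B z̄)*` is injective, `Φ` is bounded by the closed graph
theorem. It remains to see that `Φ` belongs to `𝔄*`. Decomposing along `T = A₀ + defect z₀` gives
`Γ₁ (…) = Y h + M Φ h` with `Y` in `𝔄*`, hence `(Φ h, Y h + M Φ h) ∈ Θ`. Since `0` is not in the
essential spectrum of `Θ`, there are a bounded operator `R` and a compact operator `P` with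
`θ = R θ' + P θ` on `Θ` (`LinRel.IsSelfAdj.exists_left_parametrix`). Thus
`Φ = R Y + (R M + P) Φ` with `R M + P` compact. A compact operator is the sum of an operator of norm
less than one and a finite-rank operator, so this equation puts `Φ` into `𝔄*`
(`OpFamily.IsClassOfIdeals.mem_star_of_eq_add_compact_comp`). Neither the invertibility of `Θ - M`
nor compactness of the Weyl function at other points is needed.
-/

namespace LinRel

variable {E F : Type u} [NormedAddCommGroup E] [InnerProductSpace ℂ E]
  [NormedAddCommGroup F] [InnerProductSpace ℂ F]

/-! ### Resolvents of linear relations -/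

theorem mem_inv_shift {S : Submodule ℂ (E × E)} {z : ℂ} {x y : E} :
    (x, y) ∈ inv (shift S z) ↔ (y, x + z • y) ∈ S := by
  constructor
  · rintro ⟨_, ⟨⟨a, b⟩, h, rfl⟩, hxy⟩
    obtain ⟨rfl, rfl⟩ := Prod.mk.inj hxy
    simpa using h
  · intro h
    exact ⟨(y, x), ⟨(y, x + z • y), h, by simp⟩, rfl⟩

theorem resolvent_eq_iff {S : Submodule ℂ (E × E)} {z : ℂ} (hz : z ∈ resolventSet S) {x y : E} :
    resolvent S z x = y ↔ (y, x + z • y) ∈ S := by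
  rw [← mem_inv_shift, ← graph_resolvent S hz, LinearMap.mem_graph_iff]
  exact eq_comm

theorem resolvent_mem {S : Submodule ℂ (E × E)} {z : ℂ} (hz : z ∈ resolventSet S) (x : E) :
    (resolvent S z x, x + z • resolvent S z x) ∈ S :=
  (resolvent_eq_iff hz).1 rfl

theorem resolvent_sub {S : Submodule ℂ (E × E)} {z : ℂ} (hz : z ∈ resolventSet S) {p : E × E}
    (hp : p ∈ S) : resolvent S z (p.2 - z • p.1) = p.1 := by
  rw [resolvent_eq_iff hz]
  simpa using hp

theorem mem_resolventSet_of_clm {S : Submodule ℂ (E × E)} {z : ℂ} (B : E →L[ℂ] E)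
    (hB : ∀ x y, B x = y ↔ (y, x + z • y) ∈ S) : z ∈ resolventSet S := by
  refine ⟨B, Set.mem_univ _, ?_⟩
  ext ⟨x, y⟩
  rw [LinearMap.mem_graph_iff, mem_inv_shift, ← hB]
  exact eq_comm

/-! ### Self-adjoint relations -/

theorem IsSelfAdj.mem_iff {S : Submodule ℂ (E × E)} (hS : IsSelfAdj S) {p : E × E} :
    p ∈ S ↔ ∀ a b, (a, b) ∈ S → inner ℂ b p.1 = inner ℂ a p.2 := by
  have h : p ∈ S ↔ p ∈ S.adjoint := by rw [← hS]
  rw [h, Submodule.mem_adjoint_iff]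
  simp only [sub_eq_zero]

theorem IsSelfAdj.isClosed {S : Submodule ℂ (E × E)} (hS : IsSelfAdj S) :
    IsClosed (S : Set (E × E)) := by
  have : (S : Set (E × E)) = ⋂ q : S, {p | inner ℂ q.1.2 p.1 = inner ℂ q.1.1 p.2} := by
    ext p
    rw [SetLike.mem_coe, hS.mem_iff, Set.mem_iInter]
    exact ⟨fun h q => h _ _ q.2, fun h a b hab => h ⟨(a, b), hab⟩⟩
  rw [this]
  exact isClosed_iInter fun q => isClosed_eq (by fun_prop) (by fun_prop)

/-- The resolvent set of a self-adjoint relation is symmetric about the real axis, because the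
adjoint of `(S - z)⁻¹` is `(S - z̄)⁻¹`. -/
theorem IsSelfAdj.conj_mem_resolventSet [CompleteSpace E] {S : Submodule ℂ (E × E)}
    (hS : IsSelfAdj S) {z : ℂ} (hz : z ∈ resolventSet S) :
    (starRingEnd ℂ) z ∈ resolventSet S := by
  refine mem_resolventSet_of_clm (ContinuousLinearMap.adjoint (resolvent S z)) fun x y => ?_
  rw [hS.mem_iff]
  constructor
  · rintro rfl a b hab
    have h : inner ℂ a x = inner ℂ (b - z • a) (ContinuousLinearMap.adjoint (resolvent S z) x) := by
      rw [ContinuousLinearMap.adjoint_inner_right, resolvent_sub hz hab]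
    simp only [inner_add_right, inner_smul_right, inner_sub_left, inner_smul_left] at h ⊢
    rw [h]
    ring
  · intro h
    refine ext_inner_left ℂ fun v => ?_
    have := h _ _ (resolvent_mem hz v)
    rw [ContinuousLinearMap.adjoint_inner_right]
    simp only [inner_add_right, inner_smul_right, inner_add_left, inner_smul_left] at this
    linear_combination -this

theorem IsSelfAdj.abs_im_mul_norm_le {S : Submodule ℂ (E × E)} (hS : IsSelfAdj S) (z : ℂ)
    {p : E × E} (hp : p ∈ S) : |z.im| * ‖p.1‖ ≤ ‖p.2 - z • p.1‖ := by
  have hsymm : inner ℂ p.2 p.1 = inner ℂ p.1 p.2 := hS.mem_iff.1 hp p.1 p.2 hp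
  have him : (inner ℂ p.1 p.2 : ℂ).im = 0 := by
    rw [← Complex.conj_eq_iff_im, inner_conj_symm, hsymm]
  have h1 : (inner ℂ p.1 (p.2 - z • p.1) : ℂ).im = -(z.im * ‖p.1‖ ^ 2) := by
    rw [inner_sub_right, inner_smul_right, inner_self_eq_norm_sq_to_K, Complex.sub_im, him]
    simp [Complex.mul_im, ← Complex.ofReal_pow]
  have h2 : |z.im| * ‖p.1‖ ^ 2 ≤ ‖p.1‖ * ‖p.2 - z • p.1‖ := by
    calc |z.im| * ‖p.1‖ ^ 2 = |(inner ℂ p.1 (p.2 - z • p.1) : ℂ).im| := by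
          rw [h1, abs_neg, abs_mul, abs_of_nonneg (sq_nonneg ‖p.1‖)]
      _ ≤ ‖(inner ℂ p.1 (p.2 - z • p.1) : ℂ)‖ := Complex.abs_im_le_norm _
      _ ≤ _ := norm_inner_le_norm _ _
  rcases (norm_nonneg p.1).eq_or_lt with h0 | h0
  · rw [← h0, mul_zero]
    exact norm_nonneg _
  · refine le_of_mul_le_mul_left ?_ h0
    linarith

/-- Non-real numbers belong to the resolvent set of a self-adjoint relation `S`: the map
`(f, f') ↦ f' - z f` on `S` is bounded below, and its range is dense because a vector `u`
orthogonal to it satisfies `(u, z̄ u) ∈ S`. -/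
theorem IsSelfAdj.mem_resolventSet_of_im_ne_zero [CompleteSpace E] {S : Submodule ℂ (E × E)}
    (hS : IsSelfAdj S) {z : ℂ} (hz : z.im ≠ 0) : z ∈ resolventSet S := by
  have : CompleteSpace S := hS.isClosed.completeSpace_coe
  let L : S →L[ℂ] E :=
    (ContinuousLinearMap.snd ℂ E E - z • ContinuousLinearMap.fst ℂ E E) ∘L S.subtypeL
  have hL : ∀ p : S, L p = p.1.2 - z • p.1.1 := fun p => rfl
  have hz' : 0 < |z.im| := abs_pos.2 hz
  have hbound : ∀ p : S, ‖p‖ ≤ (1 + (1 + ‖z‖) / |z.im|) * ‖L p‖ := fun p => by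
    have h1 : ‖p.1.1‖ ≤ ‖L p‖ / |z.im| := by
      rw [le_div_iff₀ hz', mul_comm]
      exact hS.abs_im_mul_norm_le z p.2
    have h2 : ‖p.1.2‖ ≤ ‖L p‖ + ‖z‖ * ‖p.1.1‖ := by
      calc ‖p.1.2‖ = ‖L p + z • p.1.1‖ := by rw [hL, sub_add_cancel]
        _ ≤ _ := (norm_add_le _ _).trans_eq (by rw [norm_smul])
    have h3 : ‖z‖ * ‖p.1.1‖ ≤ ‖z‖ * (‖L p‖ / |z.im|) :=
      mul_le_mul_of_nonneg_left h1 (norm_nonneg z)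
    have h4 : 0 ≤ ‖z‖ * (‖L p‖ / |z.im|) := by positivity
    have h5 : (1 + (1 + ‖z‖) / |z.im|) * ‖L p‖
        = ‖L p‖ + ‖L p‖ / |z.im| + ‖z‖ * (‖L p‖ / |z.im|) := by ring
    have h6 : 0 ≤ ‖L p‖ / |z.im| := by positivity
    rw [h5, Submodule.coe_norm, Prod.norm_def]
    refine max_le ?_ ?_ <;> linarith [norm_nonneg (L p)]
  have hanti : AntilipschitzWith (Real.toNNReal (1 + (1 + ‖z‖) / |z.im|)) L := by
    refine AddMonoidHomClass.antilipschitz_of_bound L fun p => ?_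
    rw [Real.coe_toNNReal _ (by positivity)]
    exact hbound p
  have hdense : L.range.topologicalClosure = ⊤ := by
    rw [Submodule.topologicalClosure_eq_top_iff, Submodule.eq_bot_iff]
    intro v hv
    rw [Submodule.mem_orthogonal] at hv
    have hmem : (v, (starRingEnd ℂ) z • v) ∈ S := hS.mem_iff.2 fun a b hab => by
      have := hv (L ⟨(a, b), hab⟩) ⟨_, rfl⟩
      rw [hL, inner_sub_left, inner_smul_left, sub_eq_zero] at this
      rw [inner_smul_right]
      exact this
    have := hS.abs_im_mul_norm_le ((starRingEnd ℂ) z) hmem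
    simp only [sub_self, norm_zero, Complex.conj_im, abs_neg] at this
    exact norm_le_zero_iff.1 (nonpos_of_mul_nonpos_right this hz')
  have hbij : Function.Bijective L :=
    (ContinuousLinearMap.bijective_iff_dense_range_and_antilipschitz L).2 ⟨hdense, _, hanti⟩
  let e := ContinuousLinearEquiv.ofBijective L (LinearMap.ker_eq_bot.2 hbij.1)
    (LinearMap.range_eq_top.2 hbij.2)
  refine mem_resolventSet_of_clm
    (ContinuousLinearMap.fst ℂ E E ∘L S.subtypeL ∘L (e.symm : E →L[ℂ] S)) fun x y => ?_
  constructor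
  · rintro rfl
    have h : L (e.symm x) = x := e.apply_symm_apply x
    rw [hL] at h
    have h' : x + z • (e.symm x).1.1 = (e.symm x).1.2 := by
      rw [← eq_sub_iff_add_eq]
      exact h.symm
    change ((e.symm x).1.1, x + z • (e.symm x).1.1) ∈ S
    rw [h']
    exact (e.symm x).2
  · intro h
    have : e.symm x = ⟨_, h⟩ := by
      rw [ContinuousLinearEquiv.symm_apply_eq]
      change x = L _
      rw [hL]
      simp
    change (e.symm x).1.1 = y
    rw [this]

/-! ### Parametrices of Fredholm relations -/

/-- A closed relation with closed range and finite-dimensional kernel has a left inverse modulo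
a compact operator. The operator `R` inverts the restriction of `S` to the orthogonal complement
of the kernel and vanishes on the orthogonal complement of the range; `P` is the orthogonal
projection onto the kernel. -/
theorem exists_left_parametrix [CompleteSpace E] [CompleteSpace F] {S : Submodule ℂ (E × F)}
    (hS : IsClosed (S : Set (E × F))) (hker : FiniteDimensional ℂ (ker S))
    (hran : IsClosed (ran S : Set F)) :
    ∃ (R : F →L[ℂ] E) (P : E →L[ℂ] E), IsCompactOperator P ∧
      ∀ p ∈ S, p.1 = R p.2 + P p.1 := by
  let N := ker S
  -- the restriction of `S` to the orthogonal complement of its kernel has the same range as `S`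
  let W : Submodule ℂ (E × F) := S ⊓ Nᗮ.comap (LinearMap.fst ℂ E F)
  have hW : IsClosed (W : Set (E × F)) :=
    hS.inter ((Submodule.isClosed_orthogonal N).preimage continuous_fst)
  have : CompleteSpace W := hW.completeSpace_coe
  let L : W →L[ℂ] F := ContinuousLinearMap.snd ℂ E F ∘L W.subtypeL
  have hdecomp : ∀ p ∈ S, (p.1 - N.starProjection p.1, p.2) ∈ W := fun p hp => by
    refine ⟨?_, Submodule.sub_starProjection_mem_orthogonal p.1⟩
    have h : (N.starProjection p.1, (0 : F)) ∈ S := N.starProjection_apply_mem p.1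
    have := S.sub_mem hp h
    rwa [Prod.mk_sub_mk, sub_zero] at this
  have hinj : Function.Injective L := by
    refine (injective_iff_map_eq_zero L).2 ?_
    rintro ⟨⟨a, b⟩, hab, ha⟩ (rfl : b = 0)
    have : a = 0 := by
      have h1 : a ∈ N := hab
      exact inner_self_eq_zero.1 ((Submodule.mem_orthogonal N a).1 ha a h1)
    subst this
    rfl
  have hrange : Set.range L = ran S := by
    ext y
    constructor
    · rintro ⟨p, rfl⟩
      exact ⟨p.1, p.2.1, rfl⟩
    · rintro ⟨p, hp, rfl⟩
      exact ⟨⟨_, hdecomp p hp⟩, rfl⟩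
  have hclo : IsClosed (Set.range L) := hrange ▸ hran
  have : CompleteSpace L.range := by
    have h : IsClosed (L.range : Set F) := hclo
    exact h.completeSpace_coe
  let e := L.equivRange hinj hclo
  refine ⟨ContinuousLinearMap.fst ℂ E F ∘L W.subtypeL ∘L (e.symm : L.range →L[ℂ] W) ∘L
    L.range.orthogonalProjectionOnto, N.starProjection, ?_, fun p hp => ?_⟩
  · exact (isCompactOperator_of_locallyCompactSpace_dom N.orthogonalProjectionOnto).clm_comp
      N.subtypeL
  · let w : W := ⟨_, hdecomp p hp⟩
    have h1 : L.range.orthogonalProjectionOnto p.2 = e w :=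
      Submodule.orthogonalProjectionOnto_mem_subspace_eq_self (e w)
    have h2 : e.symm (L.range.orthogonalProjectionOnto p.2) = w := by
      rw [h1, ContinuousLinearEquiv.symm_apply_apply]
    have h3 : p.1 = (e.symm (L.range.orthogonalProjectionOnto p.2)).1.1 + N.starProjection p.1 := by
      rw [h2]
      exact (sub_add_cancel _ _).symm
    exact h3

/-- If `0` is not in the essential spectrum of a self-adjoint relation `Θ`, then `Θ` has a left
inverse modulo a compact operator. The parametrix of the operator part is extended by zero to the
multivalued part of `Θ`, which is the orthogonal complement of the domain. -/
theorem IsSelfAdj.exists_left_parametrix [CompleteSpace E] {Θ : Submodule ℂ (E × E)}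
    (hΘ : IsSelfAdj Θ) (h0 : (0 : ℝ) ∉ essSpectrum Θ) :
    ∃ R P : E →L[ℂ] E, IsCompactOperator P ∧ ∀ p ∈ Θ, p.1 = R p.2 + P p.1 := by
  let K := (dom Θ).topologicalClosure
  have : CompleteSpace K := (Submodule.isClosed_topologicalClosure _).completeSpace_coe
  have hF : IsFredholm (opPart Θ) := by
    have h : IsFredholm (shift (opPart Θ) ((0 : ℝ) : ℂ)) := not_not.1 h0
    have hs : shift (opPart Θ) ((0 : ℝ) : ℂ) = opPart Θ := by
      rw [shift, Complex.ofReal_zero, zero_smul, sub_zero]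
      exact Submodule.map_id _
    rwa [hs] at h
  obtain ⟨R, P, hP, hRP⟩ := LinRel.exists_left_parametrix hF.1 hF.2.1 hF.2.2.1
  refine ⟨K.subtypeL ∘L R ∘L K.orthogonalProjectionOnto,
    K.subtypeL ∘L P ∘L K.orthogonalProjectionOnto,
    (hP.comp_clm K.orthogonalProjectionOnto).clm_comp K.subtypeL, fun p hp => ?_⟩
  have hp1 : p.1 ∈ K := Submodule.le_topologicalClosure _ ⟨p, hp, rfl⟩
  -- vectors orthogonal to the domain lie in the multivalued part of the adjoint, which is `Θ`
  have hmul : ((0 : E), p.2 - K.starProjection p.2) ∈ Θ := hΘ.mem_iff.2 fun a b hab => by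
    have ha : a ∈ K := Submodule.le_topologicalClosure _ ⟨(a, b), hab, rfl⟩
    rw [inner_zero_right]
    exact ((Submodule.mem_orthogonal K _).1 (Submodule.sub_starProjection_mem_orthogonal p.2)
      a ha).symm
  have hop : ((⟨p.1, hp1⟩ : K), K.orthogonalProjectionOnto p.2) ∈ opPart Θ := by
    have h := Θ.sub_mem hp hmul
    have h' : p - ((0 : E), p.2 - K.starProjection p.2) = (p.1, K.starProjection p.2) := by
      ext <;> simp
    rw [h'] at h
    exact h
  have h1 : K.orthogonalProjectionOnto p.1 = ⟨p.1, hp1⟩ :=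
    Submodule.orthogonalProjectionOnto_mem_subspace_eq_self (⟨p.1, hp1⟩ : K)
  have h2 := congrArg K.subtypeL (hRP _ hop)
  rw [map_add, ← h1] at h2
  have h3 : (K.orthogonalProjectionOnto p.1 : E) = p.1 := by rw [h1]
  exact h3.symm.trans h2

end LinRel

/-! ### Operator ideals -/

/-- A compact operator into a Hilbert space is close to its composition with the orthogonal
projection onto the span of a finite net of the image of the unit ball. -/
theorem IsCompactOperator.exists_norm_sub_starProjection_comp_le {E F : Type*}
    [NormedAddCommGroup E] [InnerProductSpace ℂ E] [NormedAddCommGroup F] [InnerProductSpace ℂ F]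
    {K : E →L[ℂ] F} (hK : IsCompactOperator K) {ε : ℝ} (hε : 0 < ε) :
    ∃ (V : Submodule ℂ F) (_ : FiniteDimensional ℂ V), ‖K - V.starProjection ∘L K‖ ≤ ε := by
  obtain ⟨C, hC, hsub⟩ := hK.image_closedBall_subset_compact (f := (K : E →ₗ[ℂ] F)) 1
  obtain ⟨t, ht, hcover⟩ := Metric.totallyBounded_iff.1 hC.totallyBounded ε hε
  have hfin : FiniteDimensional ℂ (Submodule.span ℂ t) := FiniteDimensional.span_of_finite ℂ ht
  refine ⟨Submodule.span ℂ t, hfin, ?_⟩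
  refine ContinuousLinearMap.opNorm_le_of_unit_norm (𝕜 := ℂ) hε.le fun x hx => ?_
  have hx' : K x ∈ C := hsub ⟨x, by simp [hx], rfl⟩
  obtain ⟨y, hyt, hy⟩ := Set.mem_iUnion₂.1 (hcover hx')
  calc ‖(K - (Submodule.span ℂ t).starProjection ∘L K) x‖
      = ‖K x - (Submodule.span ℂ t).starProjection (K x)‖ := rfl
    _ ≤ ‖K x - y‖ := by
      rw [Submodule.starProjection_minimal]
      exact ciInf_le ⟨0, by rintro _ ⟨w, rfl⟩; exact norm_nonneg _⟩
        (⟨y, Submodule.subset_span hyt⟩ : Submodule.span ℂ t)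
    _ ≤ ε := by
      rw [← dist_eq_norm]
      exact (Metric.mem_ball.1 hy).le

namespace OpFamily.IsClassOfIdeals

open TopologicalSpace ContinuousLinearMap

variable {𝔄 : OpFamily.{u}} {H K H₁ K₁ : Type u}
  [NormedAddCommGroup H] [InnerProductSpace ℂ H] [CompleteSpace H] [SeparableSpace H]
  [NormedAddCommGroup K] [InnerProductSpace ℂ K] [CompleteSpace K] [SeparableSpace K]
  [NormedAddCommGroup H₁] [InnerProductSpace ℂ H₁] [CompleteSpace H₁] [SeparableSpace H₁]
  [NormedAddCommGroup K₁] [InnerProductSpace ℂ K₁] [CompleteSpace K₁] [SeparableSpace K₁]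

theorem star_add (h𝔄 : 𝔄.IsClassOfIdeals) {A B : H →L[ℂ] K} (hA : A ∈ 𝔄.star H K)
    (hB : B ∈ 𝔄.star H K) : A + B ∈ 𝔄.star H K := by
  obtain ⟨A', hA', rfl⟩ := hA
  obtain ⟨B', hB', rfl⟩ := hB
  exact ⟨A' + B', h𝔄.add _ _ _ _ hA' hB', (map_add _ _ _).symm⟩

theorem star_comp (h𝔄 : 𝔄.IsClassOfIdeals) {A : H →L[ℂ] K} (hA : A ∈ 𝔄.star H K)
    (B : H₁ →L[ℂ] H) (C : K →L[ℂ] K₁) : C ∘L A ∘L B ∈ 𝔄.star H₁ K₁ := by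
  obtain ⟨A', hA', rfl⟩ := hA
  refine ⟨adjoint B ∘L A' ∘L adjoint C, h𝔄.comp _ _ _ _ _ _ _ hA', ?_⟩
  simp [adjoint_comp, comp_assoc]

theorem starProjection_mem_star (h𝔄 : 𝔄.IsClassOfIdeals) (V : Submodule ℂ H)
    [FiniteDimensional ℂ V] : V.starProjection ∈ 𝔄.star H H := by
  refine ⟨V.starProjection, ?_, ?_⟩
  · rw [(stdOrthonormalBasis ℂ V).starProjection_eq_sum_rankOne]
    refine Finset.sum_induction _ (· ∈ 𝔄 H H) (fun _ _ => h𝔄.add _ _ _ _) ?_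
      fun i _ => h𝔄.rankOne H H _ _
    simpa using h𝔄.rankOne H H 0 0
  · exact (isSelfAdjoint_iff'.1 (isSelfAdjoint_starProjection V)).symm

/-- If `(1 - C) X` belongs to the ideal and `C` is compact, then `X` belongs to the ideal: up to a
finite-rank operator `C` has norm less than one, and `1 - C` is invertible for such `C`. -/
theorem mem_star_of_eq_add_compact_comp (h𝔄 : 𝔄.IsClassOfIdeals) {X Y : H →L[ℂ] K}
    (hY : Y ∈ 𝔄.star H K) {C : K →L[ℂ] K} (hC : IsCompactOperator C) (hX : X = Y + C ∘L X) :
    X ∈ 𝔄.star H K := by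
  obtain ⟨V, hV, hnorm⟩ := hC.exists_norm_sub_starProjection_comp_le (ε := 1 / 2) (by norm_num)
  have hlt : ‖C - V.starProjection ∘L C‖ < 1 := hnorm.trans_lt (by norm_num)
  let U := Units.oneSub (C - V.starProjection ∘L C) hlt
  have hZ : Y + V.starProjection ∘L (C ∘L X) ∈ 𝔄.star H K :=
    h𝔄.star_add hY (h𝔄.star_comp (h𝔄.starProjection_mem_star V) (C ∘L X)
      (ContinuousLinearMap.id ℂ K))
  have hU : (U : K →L[ℂ] K) ∘L X = Y + V.starProjection ∘L (C ∘L X) := by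
    have h : (U : K →L[ℂ] K) = 1 - (C - V.starProjection ∘L C) := rfl
    ext x
    have hx := congrArg (fun B : H →L[ℂ] K => B x) hX
    simp only [add_apply, comp_apply] at hx
    simp only [h, comp_apply, sub_apply, one_apply_eq_self, add_apply]
    rw [← sub_eq_iff_eq_add] at hx
    rw [← hx]
    abel
  have hXU : X = (↑U⁻¹ : K →L[ℂ] K) ∘L (Y + V.starProjection ∘L (C ∘L X)) ∘L
      ContinuousLinearMap.id ℂ H := by
    rw [comp_id, ← hU, ← comp_assoc]
    change X = ((↑U⁻¹ : K →L[ℂ] K) * (U : K →L[ℂ] K)) ∘L X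
    rw [Units.inv_mul]
    rfl
  rw [hXU]
  exact h𝔄.star_comp hZ _ _

end OpFamily.IsClassOfIdeals

namespace QuasiBoundaryTriple

open LinRel ContinuousLinearMap

variable {H G : Type u} [NormedAddCommGroup H] [InnerProductSpace ℂ H]
  [NormedAddCommGroup G] [InnerProductSpace ℂ G] {A : Submodule ℂ (H × H)}

/-! ### The `γ`-field and its adjoint -/

theorem mem_defect (Γ : QuasiBoundaryTriple A G) {z : ℂ} {f : Γ.T} :
    f ∈ Γ.defect z ↔ (f : H × H).2 = z • (f : H × H).1 := by
  rw [defect, LinearMap.mem_ker, ← sub_eq_zero (a := (f : H × H).2)]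
  rfl

theorem coe_mem_A₀ (Γ : QuasiBoundaryTriple A G) {f : Γ.T} :
    (f : H × H) ∈ Γ.A₀ ↔ Γ.Γ₀ f = 0 := by
  constructor
  · rintro ⟨g, hg, hgf⟩
    rwa [← Subtype.ext hgf]
  · exact fun h => ⟨f, h, rfl⟩

theorem isSelfAdj_A₀ (Γ : QuasiBoundaryTriple A G) : IsSelfAdj Γ.A₀ := Γ.selfAdj_ker

theorem A₀_le_T (Γ : QuasiBoundaryTriple A G) : Γ.A₀ ≤ Γ.T := by
  rintro _ ⟨f, -, rfl⟩
  exact f.2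

theorem ext_le_T (Γ : QuasiBoundaryTriple A G) (Θ : Submodule ℂ (G × G)) : Γ.ext Θ ≤ Γ.T := by
  rintro _ ⟨f, -, rfl⟩
  exact f.2

theorem coe_mem_ext (Γ : QuasiBoundaryTriple A G) {Θ : Submodule ℂ (G × G)} {f : Γ.T} :
    (f : H × H) ∈ Γ.ext Θ ↔ (Γ.Γ₀ f, Γ.Γ₁ f) ∈ Θ := by
  constructor
  · rintro ⟨g, hg, hgf⟩
    rw [← Subtype.ext hgf]
    exact hg
  · exact fun h => ⟨f, h, rfl⟩

theorem denseRange_Γ₀ (Γ : QuasiBoundaryTriple A G) : DenseRange Γ.Γ₀ :=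
  (Prod.fst_surjective (α := G) (β := G)).denseRange.comp Γ.dense_ran continuous_fst

/-- For a restriction `S` of `T` with `z` in its resolvent set, the linear map
`h ↦ ((S - z)⁻¹ h, h + z (S - z)⁻¹ h)` from `H` onto `S`, regarded as a map into `T`. -/
noncomputable def resolventLift (Γ : QuasiBoundaryTriple A G) {S : Submodule ℂ (H × H)}
    (hS : S ≤ Γ.T) {z : ℂ} (hz : z ∈ resolventSet S) : H →ₗ[ℂ] Γ.T :=
  LinearMap.codRestrict Γ.T
    ((resolvent S z : H →ₗ[ℂ] H).prod (LinearMap.id + z • (resolvent S z : H →ₗ[ℂ] H)))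
    fun h => by exact hS (resolvent_mem hz h)

theorem coe_resolventLift (Γ : QuasiBoundaryTriple A G) {S : Submodule ℂ (H × H)}
    (hS : S ≤ Γ.T) {z : ℂ} (hz : z ∈ resolventSet S) (h : H) :
    (Γ.resolventLift hS hz h : H × H) = (resolvent S z h, h + z • resolvent S z h) := rfl

theorem resolventLift_sub (Γ : QuasiBoundaryTriple A G) {S : Submodule ℂ (H × H)}
    (hS : S ≤ Γ.T) {z : ℂ} (hz : z ∈ resolventSet S) {f : Γ.T} (hf : (f : H × H) ∈ S) :
    Γ.resolventLift hS hz ((f : H × H).2 - z • (f : H × H).1) = f := by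
  refine Subtype.ext ?_
  rw [coe_resolventLift, resolvent_sub hz hf, sub_add_cancel]

theorem Γ₀_resolventLift (Γ : QuasiBoundaryTriple A G) {z : ℂ} (hz : z ∈ resolventSet Γ.A₀)
    (h : H) : Γ.Γ₀ (Γ.resolventLift Γ.A₀_le_T hz h) = 0 :=
  Γ.coe_mem_A₀.1 (resolvent_mem hz h)

/-- The decomposition `T = A₀ + defect z`. -/
theorem sub_resolventLift_mem_defect (Γ : QuasiBoundaryTriple A G) {z : ℂ}
    (hz : z ∈ resolventSet Γ.A₀) (f : Γ.T) :
    f - Γ.resolventLift Γ.A₀_le_T hz ((f : H × H).2 - z • (f : H × H).1) ∈ Γ.defect z := by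
  rw [mem_defect, Submodule.coe_sub, coe_resolventLift]
  simp only [Prod.fst_sub, Prod.snd_sub, smul_sub]
  abel

/-- The map `h ↦ Γ₁ ((A₀ - z)⁻¹ h, h + z (A₀ - z)⁻¹ h)` is the adjoint of `γ(z̄)`. -/
theorem inner_Γ₀_Γ₁_resolventLift (Γ : QuasiBoundaryTriple A G) {z : ℂ}
    (hz : z ∈ resolventSet Γ.A₀) {f : Γ.T} (hf : f ∈ Γ.defect ((starRingEnd ℂ) z)) (h : H) :
    inner ℂ (Γ.Γ₀ f) (Γ.Γ₁ (Γ.resolventLift Γ.A₀_le_T hz h)) = inner ℂ (f : H × H).1 h := by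
  have hg := Γ.green (Γ.resolventLift Γ.A₀_le_T hz h) f
  rw [Γ₀_resolventLift, inner_zero_right, sub_zero] at hg
  rw [← hg, Γ.mem_defect.1 hf, coe_resolventLift]
  simp only [inner_add_right, inner_smul_right, inner_smul_left, Complex.conj_conj]
  ring

theorem resolventLift_eq_resolventLift (Γ : QuasiBoundaryTriple A G) {z w : ℂ}
    (hz : z ∈ resolventSet Γ.A₀) (hw : w ∈ resolventSet Γ.A₀) (h : H) :
    Γ.resolventLift Γ.A₀_le_T hz h =
      Γ.resolventLift Γ.A₀_le_T hw (h + (z - w) • resolvent Γ.A₀ z h) := by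
  rw [← Γ.resolventLift_sub Γ.A₀_le_T hw (f := Γ.resolventLift Γ.A₀_le_T hz h)
    (resolvent_mem hz h), coe_resolventLift]
  congr 1
  simp only [sub_smul]
  abel

theorem clm_eq_Γ₁_of_graph_eq (Γ : QuasiBoundaryTriple A G) {z : ℂ}
    (hz : z ∈ resolventSet Γ.A₀) {B : H →L[ℂ] G}
    (hB : LinearMap.graph (B : H →ₗ[ℂ] G) = (Γ.gammaField ((starRingEnd ℂ) z)).adjoint) (h : H) :
    B h = Γ.Γ₁ (Γ.resolventLift Γ.A₀_le_T hz h) := by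
  have : (h, Γ.Γ₁ (Γ.resolventLift Γ.A₀_le_T hz h)) ∈ LinearMap.graph (B : H →ₗ[ℂ] G) := by
    rw [hB, Submodule.mem_adjoint_iff]
    rintro _ _ ⟨f, hf, hfab⟩
    obtain ⟨rfl, rfl⟩ := Prod.mk.inj hfab
    exact sub_eq_zero.2 (Γ.inner_Γ₀_Γ₁_resolventLift hz hf h).symm
  exact ((LinearMap.mem_graph_iff _ _).1 this).symm

theorem clm_apply_Γ₀_of_graph_eq (Γ : QuasiBoundaryTriple A G) {z : ℂ} {M : G →L[ℂ] G}
    (hM : LinearMap.graph (M : G →ₗ[ℂ] G) = (Γ.weyl z).topologicalClosure) {f : Γ.T}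
    (hf : f ∈ Γ.defect z) : M (Γ.Γ₀ f) = Γ.Γ₁ f := by
  have h : (Γ.Γ₀ f, Γ.Γ₁ f) ∈ LinearMap.graph (M : G →ₗ[ℂ] G) := by
    rw [hM]
    exact Submodule.le_topologicalClosure _ ⟨f, hf, rfl⟩
  exact ((LinearMap.mem_graph_iff _ _).1 h).symm

theorem clm_comp_apply_eq_Γ₁_resolventLift (Γ : QuasiBoundaryTriple A G) {w : ℂ}
    (hw : w ∈ resolventSet Γ.A₀) {B : H →L[ℂ] G}
    (hB : ∀ h, B h = Γ.Γ₁ (Γ.resolventLift Γ.A₀_le_T hw h)) {z : ℂ}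
    (hz : z ∈ resolventSet Γ.A₀) :
    ∀ h, (B ∘L (ContinuousLinearMap.id ℂ H + (z - w) • resolvent Γ.A₀ z)) h =
      Γ.Γ₁ (Γ.resolventLift Γ.A₀_le_T hz h) := fun h => by
  rw [Γ.resolventLift_eq_resolventLift hz hw, ← hB]
  rfl

variable [CompleteSpace H] [CompleteSpace G]

/-- The adjoint of `h ↦ Γ₁ ((A₀ - z̄)⁻¹ h, h + z̄ (A₀ - z̄)⁻¹ h)` extends `γ(z)`. -/
theorem adjoint_apply_Γ₀ (Γ : QuasiBoundaryTriple A G) {z : ℂ}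
    (hz : (starRingEnd ℂ) z ∈ resolventSet Γ.A₀) {B : H →L[ℂ] G}
    (hB : ∀ h, B h = Γ.Γ₁ (Γ.resolventLift Γ.A₀_le_T hz h)) {f : Γ.T} (hf : f ∈ Γ.defect z) :
    adjoint B (Γ.Γ₀ f) = (f : H × H).1 := by
  refine ext_inner_right ℂ fun h => ?_
  rw [adjoint_inner_left, hB, Γ.inner_Γ₀_Γ₁_resolventLift hz (by rwa [Complex.conj_conj])]

/-- If the closure of `M(z)` is bounded and everywhere defined, then the range of `Γ₁` on `ker Γ₀`,
which is the range of each `γ(z̄)*`, is dense. Indeed Green's identity extends by continuity from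
the elements of the defect subspace at `z` to all of `G`; for a vector `φ` orthogonal to the range
it says that `(M φ, φ)` annihilates the dense set of all boundary values. -/
theorem eq_zero_of_inner_Γ₁_eq_zero (Γ : QuasiBoundaryTriple A G) {z : ℂ}
    (hz : z ∈ resolventSet Γ.A₀) (hz' : (starRingEnd ℂ) z ∈ resolventSet Γ.A₀) {B : H →L[ℂ] G}
    (hB : ∀ h, B h = Γ.Γ₁ (Γ.resolventLift Γ.A₀_le_T hz' h)) {M : G →L[ℂ] G}
    (hM : ∀ f ∈ Γ.defect z, M (Γ.Γ₀ f) = Γ.Γ₁ f) {φ : G}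
    (hφ : ∀ f, Γ.Γ₀ f = 0 → inner ℂ φ (Γ.Γ₁ f) = 0) : φ = 0 := by
  have hgreen : ∀ (g : Γ.T) (ψ : G),
      inner ℂ (g : H × H).1 (z • adjoint B ψ) - inner ℂ (g : H × H).2 (adjoint B ψ) =
        inner ℂ (Γ.Γ₀ g) (M ψ) - inner ℂ (Γ.Γ₁ g) ψ := fun g ψ => by
    refine Γ.denseRange_Γ₀.induction_on ψ (isClosed_eq (by fun_prop) (by fun_prop)) fun f => ?_
    have hf := Γ.sub_resolventLift_mem_defect hz f
    set f₁ := f - Γ.resolventLift Γ.A₀_le_T hz ((f : H × H).2 - z • (f : H × H).1) with hf₁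
    have hΓ : Γ.Γ₀ f = Γ.Γ₀ f₁ := by rw [hf₁, map_sub, Γ₀_resolventLift, sub_zero]
    rw [hΓ, Γ.adjoint_apply_Γ₀ hz' hB hf, hM f₁ hf, ← Γ.mem_defect.1 hf]
    exact Γ.green f₁ g
  have hγ : adjoint B φ = 0 := by
    refine ext_inner_right ℂ fun h => ?_
    rw [adjoint_inner_left, hB, hφ _ (Γ.Γ₀_resolventLift hz' h), inner_zero_left]
  have hzero : ∀ p : G × G, inner ℂ p.1 (M φ) - inner ℂ p.2 φ = 0 := fun p => by
    refine Γ.dense_ran.induction_on p (isClosed_eq (by fun_prop) (by fun_prop)) fun g => ?_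
    have := hgreen g φ
    rw [hγ, smul_zero, inner_zero_right, inner_zero_right, sub_zero] at this
    exact this.symm
  simpa using hzero (0, φ)

end QuasiBoundaryTriple

/-! ### The resolvent difference -/

/-- A linear map is bounded if its composition with an injective bounded operator is bounded. -/
theorem LinearMap.continuous_of_comp_injective {E F K : Type*} [NormedAddCommGroup E]
    [NormedSpace ℂ E] [CompleteSpace E] [NormedAddCommGroup F] [NormedSpace ℂ F] [CompleteSpace F]
    [NormedAddCommGroup K] [NormedSpace ℂ K] (Φ : E →ₗ[ℂ] F) (C : F →L[ℂ] K)
    (hC : Function.Injective C) (D : E →L[ℂ] K) (h : ∀ x, C (Φ x) = D x) : Continuous Φ := by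
  refine Φ.continuous_of_seq_closed_graph fun u x y hu hy => hC ?_
  rw [h]
  refine tendsto_nhds_unique (((C.continuous.tendsto y).comp hy)) ?_
  have : ⇑C ∘ Φ ∘ u = D ∘ u := funext fun n => h _
  rw [this]
  exact (D.continuous.tendsto x).comp hu

open LinRel ContinuousLinearMap in
theorem mainTheorem4 {H G : Type u}
    [NormedAddCommGroup H] [InnerProductSpace ℂ H] [CompleteSpace H]
    [TopologicalSpace.SeparableSpace H]
    [NormedAddCommGroup G] [InnerProductSpace ℂ G] [CompleteSpace G]
    (A : Submodule ℂ (H × H)) (hA_closed : IsClosed (A : Set (H × H))) (hA_symm : LinRel.IsSymm A)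
    (Γ : QuasiBoundaryTriple A G)
    (𝔄 : OpFamily.{u}) (h𝔄 : 𝔄.IsClassOfIdeals)
    (Θ : Submodule ℂ (G × G)) (hΘ : LinRel.IsSelfAdj Θ)
    (hM : ∃ z₀ : ℂ, z₀.im ≠ 0 ∧
      LinRel.IsOpIn (Γ.weyl z₀).topologicalClosure (compactOps G G))
    (hγ : ∃ z₁ ∈ LinRel.resolventSet Γ.A₀,
      LinRel.IsOpIn (Γ.gammaField z₁).adjoint (𝔄.star H G))
    (hess : (0 : ℝ) ∉ LinRel.essSpectrum Θ)
    (hAΘ : LinRel.IsSelfAdj (Γ.ext Θ)) :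
    ∀ z ∈ LinRel.resolventSet (Γ.ext Θ) ∩ LinRel.resolventSet Γ.A₀,
      LinRel.resolvent (Γ.ext Θ) z - LinRel.resolvent Γ.A₀ z ∈ (𝔄.mul 𝔄.star) H H := by
  obtain ⟨z₀, hz₀im, M, hMcompact, hMgraph⟩ := hM
  obtain ⟨z₁, hz₁, B, hBmem, hBgraph⟩ := hγ
  rintro z ⟨hzΘ, hz⟩
  have hA₀ := Γ.isSelfAdj_A₀
  have hz₀ : z₀ ∈ resolventSet Γ.A₀ := hA₀.mem_resolventSet_of_im_ne_zero hz₀im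
  have hz₀' := hA₀.conj_mem_resolventSet hz₀
  have hz₁' := hA₀.conj_mem_resolventSet hz₁
  have hz' := hA₀.conj_mem_resolventSet hz
  have hB : ∀ h, B h = Γ.Γ₁ (Γ.resolventLift Γ.A₀_le_T hz₁' h) :=
    Γ.clm_eq_Γ₁_of_graph_eq hz₁' (by rwa [Complex.conj_conj])
  have hMΓ : ∀ f ∈ Γ.defect z₀, M (Γ.Γ₀ f) = Γ.Γ₁ f :=
    fun f hf => Γ.clm_apply_Γ₀_of_graph_eq hMgraph hf
  have htotal : ∀ φ : G, (∀ f, Γ.Γ₀ f = 0 → inner ℂ φ (Γ.Γ₁ f) = 0) → φ = 0 := fun φ hφ =>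
    Γ.eq_zero_of_inner_Γ₁_eq_zero hz₀ hz₀' (Γ.clm_comp_apply_eq_Γ₁_resolventLift hz₁' hB hz₀') hMΓ hφ
  have hadj_inj : ∀ {w : ℂ} (hw : w ∈ resolventSet Γ.A₀) (C : H →L[ℂ] G),
      (∀ h, C h = Γ.Γ₁ (Γ.resolventLift Γ.A₀_le_T hw h)) → ∀ φ, adjoint C φ = 0 → φ = 0 :=
    fun hw C hC φ hφ => htotal φ fun f hf => by
      rw [← Γ.resolventLift_sub Γ.A₀_le_T hw (Γ.coe_mem_A₀.2 hf), ← hC, ← adjoint_inner_left, hφ,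
        inner_zero_left]
  have hsep : TopologicalSpace.SeparableSpace G := by
    have hdense : B.range.topologicalClosure = ⊤ := by
      rw [Submodule.topologicalClosure_eq_top_iff, Submodule.eq_bot_iff]
      refine fun φ hφ => hadj_inj hz₁' B hB φ (ext_inner_left ℂ fun h => ?_)
      rw [adjoint_inner_right, inner_zero_right]
      exact (Submodule.mem_orthogonal _ _).1 hφ _ ⟨h, rfl⟩
    have : DenseRange B := Submodule.dense_iff_topologicalClosure_eq_top.2 hdense
    exact this.separableSpace B.continuous
  -- `Bz` is `γ(z)*`, and its adjoint is the closure of `γ(z)`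
  set Bz : H →L[ℂ] G :=
    B ∘L (ContinuousLinearMap.id ℂ H +
      ((starRingEnd ℂ) z - (starRingEnd ℂ) z₁) • resolvent Γ.A₀ ((starRingEnd ℂ) z))
  have hBz := Γ.clm_comp_apply_eq_Γ₁_resolventLift hz₁' hB hz'
  have hBzmem : adjoint Bz ∈ 𝔄 G H := by
    obtain ⟨C, hC, hCB⟩ := h𝔄.star_comp hBmem (ContinuousLinearMap.id ℂ H +
      ((starRingEnd ℂ) z - (starRingEnd ℂ) z₁) • resolvent Γ.A₀ ((starRingEnd ℂ) z))
      (ContinuousLinearMap.id ℂ G)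
    have : Bz = adjoint C := hCB
    rwa [this, adjoint_adjoint]
  -- `lift h` is `((A_Θ - z)⁻¹ h, h + z (A_Θ - z)⁻¹ h)`
  set lift := Γ.resolventLift (Γ.ext_le_T Θ) hzΘ
  set Φ₀ : H →ₗ[ℂ] G := Γ.Γ₀ ∘ₗ lift
  have hfactor : ∀ h, adjoint Bz (Φ₀ h) =
      (resolvent (Γ.ext Θ) z - resolvent Γ.A₀ z) h := fun h => by
    set f := lift h - Γ.resolventLift Γ.A₀_le_T hz h with hf
    have hfdef : f ∈ Γ.defect z := by
      rw [Γ.mem_defect, hf, Submodule.coe_sub, Γ.coe_resolventLift, Γ.coe_resolventLift]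
      simp only [Prod.fst_sub, Prod.snd_sub, smul_sub]
      abel
    have hfΓ : Γ.Γ₀ f = Φ₀ h := by
      rw [hf, map_sub, Γ.Γ₀_resolventLift, sub_zero]
      rfl
    rw [← hfΓ, Γ.adjoint_apply_Γ₀ hz' hBz hfdef]
    rfl
  have hinj : Function.Injective (adjoint Bz) :=
    (injective_iff_map_eq_zero (adjoint Bz)).2 (hadj_inj hz' Bz hBz)
  let Φ : H →L[ℂ] G := ⟨Φ₀, Φ₀.continuous_of_comp_injective (adjoint Bz) hinj _ hfactor⟩
  obtain ⟨R, P, hP, hRP⟩ := hΘ.exists_left_parametrix hess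
  -- `E h` is `f' - z₀ f` for `(f, f') = lift h`, so that the component of `lift h` in `A₀` along
  -- `T = A₀ + defect z₀` has first entry `(A₀ - z₀)⁻¹ E h`
  set E : H →L[ℂ] H := ContinuousLinearMap.id ℂ H + (z - z₀) • resolvent (Γ.ext Θ) z
  set B₀ : H →L[ℂ] G :=
    B ∘L (ContinuousLinearMap.id ℂ H + (z₀ - (starRingEnd ℂ) z₁) • resolvent Γ.A₀ z₀)
  have hB₀ := Γ.clm_comp_apply_eq_Γ₁_resolventLift hz₁' hB hz₀
  have hΓ₁ : ∀ h, Γ.Γ₁ (lift h) = B₀ (E h) + M (Φ h) := fun h => by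
    have hE : (lift h : H × H).2 - z₀ • (lift h : H × H).1 = E h := by
      change h + z • resolvent (Γ.ext Θ) z h - z₀ • resolvent (Γ.ext Θ) z h =
        h + (z - z₀) • resolvent (Γ.ext Θ) z h
      rw [sub_smul]
      abel
    have hdef := Γ.sub_resolventLift_mem_defect hz₀ (lift h)
    rw [hE] at hdef
    have h1 := hMΓ _ hdef
    rw [map_sub Γ.Γ₀, map_sub Γ.Γ₁, Γ.Γ₀_resolventLift, sub_zero, ← hB₀ (E h)] at h1
    exact eq_add_of_sub_eq' h1.symm
  have hΦ : Φ = R ∘L B ∘L ((ContinuousLinearMap.id ℂ H +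
      (z₀ - (starRingEnd ℂ) z₁) • resolvent Γ.A₀ z₀) ∘L E) + (R ∘L M + P) ∘L Φ := by
    ext h
    have h1 : (Γ.Γ₀ (lift h), Γ.Γ₁ (lift h)) ∈ Θ := Γ.coe_mem_ext.1 (resolvent_mem hzΘ h)
    have h2 := hRP _ h1
    rw [hΓ₁ h, map_add, add_assoc] at h2
    exact h2
  have hcompact : IsCompactOperator (R ∘L M + P) :=
    (IsCompactOperator.clm_comp (show IsCompactOperator M from hMcompact) R).add hP
  have hΦmem : Φ ∈ 𝔄.star H G :=
    h𝔄.mem_star_of_eq_add_compact_comp (h𝔄.star_comp hBmem _ R) hcompact hΦ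
  exact ⟨G, _, _, _, hsep, adjoint Bz, hBzmem, Φ, hΦmem,
    ContinuousLinearMap.ext fun h => (hfactor h).symm⟩
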